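/- Let $r\ge 2$. An $r$-graph is a finite hypergraph all of whose edges have exactly $r$ vertices; write $v(F)$ and $e(F)$ for the numbers of vertices and edges of an $r$-graph $F$. It is $r$-partite if its vertex set can be partitioned into $r$ (possibly empty) parts such that every edge contains exactly one vertex of each part. For $r$-graphs $F$ and $H$ with $v(H)\ge 1$, a homomorphism from $F$ to $H$ is a map $V(F)\to V(H)$ under which the image of every edge of $F$ is an edge of $H$; let $\mathrm{hom}(F,H)$ be the number of homomorphisms, and let $t_F(H)=\mathrm{hom}(F,H)/v(H)^{v(F)}$. Let $K_r^{(r)}$ be the $r$-graph with $r$ vertices and a single edge. The Sidorenko exponent of an $r$-partite $r$-graph $F$ is $$s(F)=\sup\{s\ge 0:\ \text{there is an } r\text{-graph } H \text{ with } t_F(H)=t_{K_r^{(r)}}(H)^s>0\}\in[0,\infty].$$ Theorem. Let $F$ be an $r$-partite $r$-graph with $e(F)=c\cdot v(F)$, where $c$ is a positive real number. Then $$s(F)\le 2c\cdot v(F)^{r-1}.$$ -/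

import Mathlib

open scoped ENNReal

/-- An `r`-graph (`r`-uniform hypergraph) with vertex set `V`: a finite set of edges, each of which
is a set of exactly `r` vertices. It is used with finite vertex types only. -/
structure RGraph (r : ℕ) (V : Type*) where
  /-- The edges. -/
  edges : Finset (Finset V)
  /-- Every edge has exactly `r` vertices. -/
  card_of_mem : ∀ e ∈ edges, e.card = r

namespace RGraph

/-- The complete `r`-graph on `V`: all `r`-subsets of `V` are edges. -/
def complete (r : ℕ) (V : Type*) [Fintype V] : RGraph r V where
  edges := Finset.univ.powersetCard r
  card_of_mem _ he := (Finset.mem_powersetCard.1 he).2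

/-- `F` is `r`-partite: the vertices can be split into `r` parts (`χ v` is the part of `v`) such
that every edge has exactly one vertex in each part. -/
def IsRPartite {r : ℕ} {V : Type*} (F : RGraph r V) : Prop :=
  ∃ χ : V → Fin r, ∀ e ∈ F.edges, ∀ i : Fin r, ∃! v, v ∈ e ∧ χ v = i

/-- `φ` is a homomorphism from `F` to `H`: the image of every edge of `F` is an edge of `H`. -/
def IsHom {r : ℕ} {V W : Type*} (F : RGraph r V) (H : RGraph r W) (φ : V → W) : Prop :=
  ∀ e ∈ F.edges, ∃ f ∈ H.edges, φ '' (e : Set V) = (f : Set W)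

/-- `hom(F, H)`, the number of homomorphisms from `F` to `H`. -/
noncomputable def homCount {r : ℕ} {V W : Type*} (F : RGraph r V) (H : RGraph r W) : ℕ :=
  Nat.card {φ : V → W // F.IsHom H φ}

/-- The homomorphism density `t_F(H) = hom(F, H) / v(H) ^ v(F)`. -/
noncomputable def homDensity {r : ℕ} {V W : Type*} [Fintype V] [Fintype W]
    (F : RGraph r V) (H : RGraph r W) : ℝ :=
  (F.homCount H : ℝ) / (Fintype.card W : ℝ) ^ Fintype.card V

/-- The set of all real `s ≥ 0` for which there is a (finite, non-null) `r`-graph `H` with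
`t_F(H) = t_K(H) ^ s > 0`, where `K` is the `r`-graph on `r` vertices with a single edge. -/
def sidorenkoSet {r : ℕ} {V : Type*} [Fintype V] (F : RGraph r V) : Set ℝ :=
  {s | 0 ≤ s ∧ ∃ (W : Type) (_ : Fintype W) (_ : Nonempty W) (H : RGraph r W),
    F.homDensity H = (complete r (Fin r)).homDensity H ^ s ∧ 0 < F.homDensity H}

/-- The Sidorenko exponent `s(F)`, the supremum of `sidorenkoSet F`, taken in `[0, ∞]` (so that an
unbounded set has supremum `∞`). -/
noncomputable def sidorenkoExponent {r : ℕ} {V : Type*} [Fintype V] (F : RGraph r V) : ℝ≥0∞ :=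
  ⨆ s ∈ F.sidorenkoSet, ENNReal.ofReal s

end RGraph

/-! Write `r = k + 2` and let `p` be the edge density of `H`. It suffices that `t_F(H) ≥ p ^ (2 e(F)
v(F) ^ k)`: as `p < 1`, larger powers of `p` are smaller. Replace each of the last `k` vertex
classes by `V`-indexed samples `ψ`. The product of the edge indicator over all choices from `ψ` is a
weighted bipartite graph `L ψ`, whose mean density is at least `p ^ (v(F) ^ k)` by iterated Jensen
(`pow_expect_le_expect_prod`). Let `E` be the projection of the edges of `F` to the first two parts.
For every `ψ`, `E` has density at least (density of `L ψ`) `^ (2 |E|)` in `L ψ`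
(`pow_expect_le_expect_bipartite`, an entropy-type argument). A copy of `E` in `L ψ` yields a
homomorphism from `F`, since every possible completion of each pair in `E` is already an edge. A
last use of Jensen averages over `ψ`. -/

open scoped BigOperators

namespace RGraph

universe u v

/-! ### Averages over product spaces, Jensen and blow-ups -/

section Averages

variable {ι κ X A : Type*} [Fintype ι] [Fintype κ] [Fintype X]

theorem expect_expect (f : ι → κ → ℝ) : 𝔼 i, 𝔼 j, f i j = 𝔼 x : ι × κ, f x.1 x.2 := by
  rw [← Finset.univ_product_univ, Finset.expect_product]

theorem expect_mono {f g : ι → ℝ} (h : ∀ i, f i ≤ g i) : 𝔼 i, f i ≤ 𝔼 i, g i :=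
  Finset.expect_le_expect fun i _ => h i

theorem expect_nonneg' {f : ι → ℝ} (h : ∀ i, 0 ≤ f i) : 0 ≤ 𝔼 i, f i :=
  Finset.expect_nonneg fun i _ => h i

theorem expect_prod_apply [Fintype A] [DecidableEq A] (g : A → X → ℝ) :
    𝔼 x : A → X, ∏ a, g a (x a) = ∏ a, 𝔼 t, g a t := by
  simp only [Fintype.expect_eq_sum_div_card, Finset.prod_div_distrib, Finset.prod_univ_sum,
    Fintype.piFinset_univ, Fintype.card_fun, Finset.prod_const, Finset.card_univ, Nat.cast_pow]

theorem pow_expect_le [Nonempty ι] {f : ι → ℝ} (hf : ∀ i, 0 ≤ f i) (n : ℕ) :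
    (𝔼 i, f i) ^ n ≤ 𝔼 i, f i ^ n := by
  have h := Real.pow_arith_mean_le_arith_mean_pow Finset.univ
    (fun _ : ι => (Fintype.card ι : ℝ)⁻¹) f (fun _ _ => by positivity)
    (by simp) (fun i _ => hf i) n
  simpa only [Fintype.expect_eq_sum_div_card, ← Finset.mul_sum, div_eq_inv_mul] using h

/-- Jensen's inequality for the logarithm, with respect to a density `q`. -/
theorem expect_mul_log_le {q z : ι → ℝ} {C : ℝ} (hq : ∀ i, 0 ≤ q i) (hq1 : 𝔼 i, q i = 1)
    (hz : ∀ i, 0 < q i → 0 < z i) (hC : 𝔼 i, q i * z i ≤ C) :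
    0 < C ∧ 𝔼 i, q i * Real.log (z i) ≤ Real.log C := by
  have hpos : 0 < C := by
    refine lt_of_lt_of_le ?_ hC
    obtain ⟨i, -, hi⟩ := Finset.exists_ne_zero_of_expect_ne_zero
      (s := Finset.univ) (f := q) (by rw [hq1]; exact one_ne_zero)
    have hi' := lt_of_le_of_ne (hq i) (Ne.symm hi)
    refine Finset.expect_pos' (fun j _ => ?_) ⟨i, Finset.mem_univ _, mul_pos hi' (hz i hi')⟩
    rcases (hq j).eq_or_lt with h | h
    · simp [← h]
    · exact (mul_pos h (hz j h)).le
  refine ⟨hpos, ?_⟩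
  -- The tangent line bound `log u ≤ u - 1` at `u = z i / C`.
  have key : ∀ i, q i * Real.log (z i) ≤ q i * z i * C⁻¹ + q i * (Real.log C - 1) := by
    intro i
    rcases (hq i).eq_or_lt with h | h
    · simp [← h]
    · have h1 := Real.log_le_sub_one_of_pos (div_pos (hz i h) hpos)
      rw [Real.log_div (hz i h).ne' hpos.ne', div_eq_mul_inv] at h1
      nlinarith
  have h2 := expect_mono key
  rw [Finset.expect_add_distrib, ← Finset.expect_mul, ← Finset.expect_mul, hq1] at h2
  have h3 : (𝔼 i, q i * z i) * C⁻¹ ≤ 1 := by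
    rw [← div_eq_mul_inv]; exact (div_le_one hpos).2 hC
  linarith

/-- Exchanging the coordinate `x a` with an independent `t` is an involution of the pairs `(x, t)`.
-/
theorem expect_update [Nonempty X] [Fintype A] [DecidableEq A] (a : A) (F : (A → X) → ℝ) :
    𝔼 x : A → X, F x = 𝔼 x : A → X, 𝔼 t, F (Function.update x a t) := by
  have h : 𝔼 x : A → X, F x = 𝔼 x : A → X, 𝔼 _t : X, F x :=
    Finset.expect_congr rfl fun x _ => (Fintype.expect_const _).symm
  rw [h, expect_expect (fun x (_ : X) => F x), expect_expect (fun x t => F (Function.update x a t))]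
  have hinv : Function.Involutive
      (fun p : (A → X) × X => (Function.update p.1 a p.2, p.1 a)) := by
    rintro ⟨x, t⟩
    refine Prod.ext ?_ ?_
    · simp only [Function.update_idem, Function.update_eq_self]
    · exact Function.update_self _ _ _
  refine Fintype.expect_equiv hinv.toPerm _ _ fun p => ?_
  simp [Function.Involutive.toPerm]

/-- Coordinates in `T` are independent of a function of the remaining coordinates. -/
theorem expect_prod_mul [Nonempty X] [Fintype A] [DecidableEq A] (g : X → ℝ) (T : Finset A)
    (G : (A → X) → ℝ) (hG : ∀ x x', (∀ a ∉ T, x a = x' a) → G x = G x') :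
    𝔼 x : A → X, (∏ a ∈ T, g (x a)) * G x = (𝔼 t, g t) ^ T.card * 𝔼 x, G x := by
  induction T using Finset.induction_on with
  | empty => simp
  | insert a T ha ih =>
    have ih := ih fun x x' h => hG x x' fun b hb => h b fun hb' => hb (Finset.mem_insert_of_mem hb')
    rw [Finset.card_insert_of_notMem ha, pow_succ', mul_assoc, ← ih, expect_update a]
    simp_rw [Finset.prod_insert ha]
    have : ∀ (x : A → X) (t : X), g (Function.update x a t a) *
        (∏ b ∈ T, g (Function.update x a t b)) * G (Function.update x a t) =
        g t * ((∏ b ∈ T, g (x b)) * G x) := by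
      intro x t
      rw [hG (Function.update x a t) x, Function.update_self, mul_assoc]
      · congr 2
        refine Finset.prod_congr rfl fun b hb => ?_
        rw [Function.update_of_ne]; rintro rfl; exact ha hb
      · intro b hb
        rw [Function.update_of_ne]; rintro rfl; exact hb (Finset.mem_insert_self _ _)
    simp_rw [this, ← Finset.expect_mul, ← Finset.mul_expect]

/-- Averaging over a map `φ` may be replaced by averaging over a family `ψ` of maps of which each
`v` uses the member with index `χ v`. -/
theorem expect_diagonal {V R : Type*} [Fintype V] [DecidableEq V] [Fintype R] [DecidableEq R]
    [Nonempty X] (χ : V → R) (f : (V → X) → ℝ) :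
    𝔼 φ : V → X, f φ = 𝔼 ψ : R → V → X, f fun v => ψ (χ v) v := by
  have h1 : 𝔼 φ : V → X, f φ = 𝔼 p : (R → V → X) × (V → X), f p.2 := by
    rw [← expect_expect (fun (_ : R → V → X) φ => f φ), Fintype.expect_const]
  have h2 : 𝔼 ψ : R → V → X, f (fun v => ψ (χ v) v) =
      𝔼 p : (R → V → X) × (V → X), f fun v => p.1 (χ v) v := by
    rw [← expect_expect (fun (ψ : R → V → X) (_ : V → X) => f fun v => ψ (χ v) v)]
    simp_rw [Fintype.expect_const]
  rw [h1, h2]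
  have hinv : Function.Involutive (fun p : (R → V → X) × (V → X) =>
      ((fun i v => if i = χ v then p.2 v else p.1 i v), fun v => p.1 (χ v) v)) := by
    rintro ⟨ψ, φ⟩
    ext i v
    · simp only
      split_ifs with h <;> simp [h]
    · simp
  refine Fintype.expect_equiv hinv.toPerm _ _ fun p => ?_
  simp [Function.Involutive.toPerm]

theorem expect_fin_succ {k : ℕ} {M : Type*} [Fintype M] (f : (Fin (k + 1) → M) → ℝ) :
    𝔼 w, f w = 𝔼 x : M, 𝔼 w : Fin k → M, f (Fin.cons x w) := by
  rw [expect_expect]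
  exact (Fintype.expect_equiv (Fin.consEquiv fun _ : Fin (k + 1) => M) _ _ fun p => rfl).symm

theorem prod_fin_succ {k : ℕ} {M : Type*} [Fintype M] (f : (Fin (k + 1) → M) → ℝ) :
    ∏ w, f w = ∏ w : Fin k → M, ∏ x : M, f (Fin.cons x w) := by
  rw [← Fintype.prod_prod_type_right']
  exact (Fintype.prod_equiv (Fin.consEquiv fun _ : Fin (k + 1) => M) _ _ fun p => rfl).symm

/-- Blowing up each of the `k` coordinates `V`-fold raises an average to the power `|V| ^ k` at
most. -/
theorem pow_expect_le_expect_prod {V : Type u} {X : Type v} [Fintype V] [DecidableEq V] [Fintype X]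
    -- The parameter space `Z` varies so that the induction can absorb a blown-up coordinate: `Z`
    -- becomes `Z × (V → X)`, which stays in the same universe.
    [Nonempty X] (k : ℕ) : ∀ {Z : Type (max u v)} [Fintype Z] [Nonempty Z] (f : Z → (Fin k → X) → ℝ), (∀ ζ w, 0 ≤ f ζ w) →
      (𝔼 ζ, 𝔼 w, f ζ w) ^ (Fintype.card V ^ k) ≤
        𝔼 ζ, 𝔼 ψ : Fin k → V → X, ∏ z : Fin k → V, f ζ fun i => ψ i (z i) := by
  induction k with
  | zero =>
    intro Z _ _ f hf
    simp only [pow_zero, pow_one, Finset.univ_unique, Finset.expect_singleton,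
      Finset.prod_singleton]
    exact le_of_eq (Finset.expect_congr rfl fun ζ _ => congrArg _ (Subsingleton.elim _ _))
  | succ k ih =>
    intro Z _ _ f hf
    have hcons : ∀ (x : V → X) (ψ : Fin k → V → X) (v : V) (z : Fin k → V),
        (fun i => (Fin.cons x ψ : Fin (k + 1) → V → X) i ((Fin.cons v z : Fin (k + 1) → V) i)) =
          Fin.cons (x v) fun i => ψ i (z i) := by
      intro x ψ v z
      funext i
      refine Fin.cases ?_ (fun i => ?_) i <;> simp
    simp_rw [expect_fin_succ, prod_fin_succ, hcons]
    have h := ih (Z := Z × (V → X)) (fun ζ w => ∏ v, f ζ.1 (Fin.cons (ζ.2 v) w))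
      fun ζ w => Finset.prod_nonneg fun _ _ => hf _ _
    rw [← expect_expect (fun ζ (x : V → X) => 𝔼 ψ : Fin k → V → X, ∏ z : Fin k → V,
      ∏ v, f ζ (Fin.cons (x v) fun i => ψ i (z i)))] at h
    refine le_trans ?_ h
    rw [pow_succ', pow_mul]
    refine pow_le_pow_left₀ (pow_nonneg (expect_nonneg' fun ζ => expect_nonneg' fun x =>
      expect_nonneg' fun w => hf _ _) _) ?_ _
    rw [← expect_expect (fun ζ (x : V → X) => 𝔼 w : Fin k → X, ∏ v, f ζ (Fin.cons (x v) w))]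
    -- For fixed `ζ` and `w` the `V` samples are independent, so their product averages to a power,
    -- ready for Jensen.
    have h2 : ∀ ζ, 𝔼 x : V → X, 𝔼 w : Fin k → X, ∏ v, f ζ (Fin.cons (x v) w) =
        𝔼 w : Fin k → X, (𝔼 t, f ζ (Fin.cons t w)) ^ Fintype.card V := by
      intro ζ
      rw [Finset.expect_comm]
      refine Finset.expect_congr rfl fun w _ => ?_
      rw [expect_prod_apply (fun _ t => f ζ (Fin.cons t w)), Finset.prod_const, Finset.card_univ]
    simp_rw [h2]
    have h3 : ∀ ζ, 𝔼 x : X, 𝔼 w : Fin k → X, f ζ (Fin.cons x w) =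
        𝔼 w : Fin k → X, 𝔼 x, f ζ (Fin.cons x w) := fun ζ => Finset.expect_comm _ _ _
    simp_rw [h3]
    rw [expect_expect (fun ζ (w : Fin k → X) => 𝔼 x, f ζ (Fin.cons x w)),
      expect_expect (fun ζ (w : Fin k → X) => (𝔼 x, f ζ (Fin.cons x w)) ^ Fintype.card V)]
    exact pow_expect_le (fun _ => expect_nonneg' fun _ => hf _ _) _

end Averages

/-! ### The bipartite case -/

section Bipartite

variable {X Y A B : Type*} [Fintype X] [Fintype Y] [Fintype A] [Fintype B] [DecidableEq A]
  [Nonempty X] [Nonempty Y]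

/-- Counting neighbourhood systems: `S b` is the set of neighbours of `b`, all of them in `A₀`. The
proof compares with the density of an edge `(x, y)` and independent further neighbours of `y`. -/
theorem pow_expect_le_expect_prod_neighbors (W : X → Y → ℝ) (h0 : ∀ x y, 0 ≤ W x y)
    (h1 : ∀ x y, W x y ≤ 1) (A₀ : Finset A) (hA : A₀.Nonempty) (S : B → Finset A)
    (hS : ∀ b, S b ⊆ A₀) (hp : 0 < 𝔼 y, 𝔼 x, W x y) :
    (𝔼 y, 𝔼 x, W x y) ^ (A₀.card + ∑ b, (S b).card) ≤
      𝔼 x : A → X, ∏ b, 𝔼 y, ∏ a ∈ S b, W (x a) y := by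
  set p := 𝔼 y, 𝔼 x, W x y with hpdef
  let lam : Y → ℝ := fun y => 𝔼 x, W x y
  let d : B → (A → X) → ℝ := fun b x => 𝔼 y, ∏ a ∈ S b, W (x a) y
  let w : Y → (A → X) → ℝ := fun y x => ∏ a ∈ A₀, W (x a) y
  -- Density of this experiment: draw `y` with bias `lam y`, then independent random neighbours of
  -- `y` for the coordinates in `A₀`; the others stay uniform.
  let q : Y × (A → X) → ℝ := fun i => lam i.1 / p * (w i.1 i.2 / lam i.1 ^ A₀.card)
  have hlam : ∀ y, 0 ≤ lam y := fun y => expect_nonneg' fun x => h0 x y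
  have hw : ∀ y x, 0 ≤ w y x := fun y x => Finset.prod_nonneg fun _ _ => h0 _ _
  have hw1 : ∀ y x, w y x ≤ 1 := fun y x => Finset.prod_le_one (fun _ _ => h0 _ _) fun _ _ => h1 _ _
  have hd : ∀ b x, 0 ≤ d b x := fun b x =>
    expect_nonneg' fun y => Finset.prod_nonneg fun _ _ => h0 _ _
  have hq : ∀ i, 0 ≤ q i := fun i => mul_nonneg (div_nonneg (hlam _) hp.le)
    (div_nonneg (hw _ _) (pow_nonneg (hlam _) _))
  have hlp : ∀ i, 0 < q i → 0 < lam i.1 := by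
    intro i hi
    refine (hlam _).lt_of_ne fun h => hi.ne' ?_
    simp [q, ← h]
  have hwp : ∀ i, 0 < q i → 0 < w i.1 i.2 := by
    intro i hi
    refine (hw _ _).lt_of_ne fun h => hi.ne' ?_
    simp [q, ← h]
  have hdp : ∀ b i, 0 < q i → 0 < d b i.2 := by
    intro b i hi
    refine Finset.expect_pos' (fun y _ => Finset.prod_nonneg fun _ _ => h0 _ _)
      ⟨i.1, Finset.mem_univ _, Finset.prod_pos fun a ha => (h0 _ _).lt_of_ne fun h => ?_⟩
    exact (hwp i hi).ne' (Finset.prod_eq_zero (hS b ha) h.symm)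
  have hwE : ∀ y, 𝔼 x, w y x = lam y ^ A₀.card := by
    intro y
    have := expect_prod_mul (fun x => W x y) A₀ (fun _ => (1 : ℝ)) fun _ _ _ => rfl
    simpa only [mul_one, Fintype.expect_const] using this
  have hq1 : 𝔼 i, q i = 1 := by
    rw [← expect_expect (fun y x => lam y / p * (w y x / lam y ^ A₀.card))]
    have : ∀ y, 𝔼 x, lam y / p * (w y x / lam y ^ A₀.card) = lam y / p := by
      intro y
      rw [← Finset.mul_expect, ← Finset.expect_div, hwE]
      rcases eq_or_ne (lam y) 0 with h | h
      · simp [h]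
      · rw [div_self (pow_ne_zero _ h), mul_one]
    simp_rw [this]
    rw [← Finset.expect_div]
    exact div_self hp.ne'
  set ℓ := 𝔼 i, q i * Real.log (lam i.1) with hℓ
  have hqc : ∀ c : ℝ, 𝔼 i, q i * c = c := fun c => by rw [← Finset.expect_mul, hq1, one_mul]
  -- Size bias favours large degrees: the `q`-mean of `p / lam` is at most `1`.
  have hℓp : Real.log p ≤ ℓ := by
    have h := (expect_mul_log_le (z := fun i => p / lam i.1) (C := 1) hq hq1
      (fun i hi => div_pos hp (hlp i hi)) ?_).2
    · have e : ∀ i, q i * Real.log (p / lam i.1) =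
          q i * Real.log p - q i * Real.log (lam i.1) := by
        intro i
        rcases (hq i).eq_or_lt with h | h
        · simp [← h]
        · rw [Real.log_div hp.ne' (hlp i h).ne', mul_sub]
      simp_rw [e] at h
      rw [Finset.expect_sub_distrib, hqc, Real.log_one, ← hℓ] at h
      linarith
    · rw [← expect_expect (fun y x => lam y / p * (w y x / lam y ^ A₀.card) * (p / lam y))]
      refine Finset.expect_le Finset.univ_nonempty fun y _ => ?_
      rw [← Finset.expect_mul, ← Finset.mul_expect, ← Finset.expect_div, hwE]
      rcases eq_or_ne (lam y) 0 with h | h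
      · simp [h]
      · rw [div_self (pow_ne_zero _ h)]
        refine le_of_eq ?_
        field_simp
  have hb : ∀ b, ((S b).card : ℝ) * Real.log p ≤ 𝔼 i, q i * Real.log (d b i.2) := by
    intro b
    rcases (S b).eq_empty_or_nonempty with hSb | hSb
    · have : ∀ x, d b x = 1 := fun x => by simp [d, hSb]
      simp [hSb, this]
    -- This `z` is the inverse of the `q`-marginal density on `y` and the coordinates in `S b`,
    -- times the density of a uniformly chosen common neighbour `y` of them.
    have h := (expect_mul_log_le (z := fun i => p * lam i.1 ^ (S b).card / lam i.1 / d b i.2)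
      (C := 1) hq hq1 (fun i hi => div_pos (div_pos (mul_pos hp (pow_pos (hlp i hi) _))
        (hlp i hi)) (hdp b i hi)) ?_).2
    · have e : ∀ i, q i * Real.log (p * lam i.1 ^ (S b).card / lam i.1 / d b i.2) =
          q i * Real.log p + q i * Real.log (lam i.1) * (((S b).card : ℝ) - 1)
            - q i * Real.log (d b i.2) := by
        intro i
        rcases (hq i).eq_or_lt with h | h
        · simp [← h]
        · have hl := hlp i h
          have hdi := hdp b i h
          rw [Real.log_div (by positivity) hdi.ne', Real.log_div (by positivity) hl.ne',
            Real.log_mul hp.ne' (by positivity), Real.log_pow]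
          ring
      simp_rw [e] at h
      rw [Finset.expect_sub_distrib, Finset.expect_add_distrib, hqc, Real.log_one,
        ← Finset.expect_mul, ← hℓ] at h
      have hk : (1 : ℝ) ≤ (S b).card := by exact_mod_cast hSb.card_pos
      nlinarith [mul_le_mul_of_nonneg_right hℓp (sub_nonneg.2 hk)]
    · rw [← expect_expect (fun y x => lam y / p * (w y x / lam y ^ A₀.card) *
        (p * lam y ^ (S b).card / lam y / d b x))]
      have hstep : ∀ y, 𝔼 x, lam y / p * (w y x / lam y ^ A₀.card) *
          (p * lam y ^ (S b).card / lam y / d b x) ≤ 𝔼 x, (∏ a ∈ S b, W (x a) y) / d b x := by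
        intro y
        rcases eq_or_ne (lam y) 0 with h | h
        · simp only [h, zero_div, zero_mul, Finset.expect_const_zero]
          exact expect_nonneg' fun x =>
            div_nonneg (Finset.prod_nonneg fun _ _ => h0 _ _) (hd _ _)
        refine le_of_eq ?_
        have e : ∀ x, lam y / p * (w y x / lam y ^ A₀.card) *
            (p * lam y ^ (S b).card / lam y / d b x) = (lam y ^ (A₀ \ S b).card)⁻¹ *
              ((∏ a ∈ A₀ \ S b, W (x a) y) * ((∏ a ∈ S b, W (x a) y) / d b x)) := by
          intro x
          have hc : lam y ^ A₀.card = lam y ^ (A₀ \ S b).card * lam y ^ (S b).card := by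
            rw [← pow_add, Finset.card_sdiff_add_card_eq_card (hS b)]
          have hww : w y x = (∏ a ∈ A₀ \ S b, W (x a) y) * ∏ a ∈ S b, W (x a) y :=
            (Finset.prod_sdiff (hS b)).symm
          rw [hc, hww]
          have := hp.ne'
          field_simp
        simp_rw [e]
        rw [← Finset.mul_expect, expect_prod_mul (fun x => W x y) (A₀ \ S b)
          (fun x => (∏ a ∈ S b, W (x a) y) / d b x), ← mul_assoc]
        · change (lam y ^ (A₀ \ S b).card)⁻¹ * lam y ^ (A₀ \ S b).card * _ = _
          rw [inv_mul_cancel₀ (pow_ne_zero _ h), one_mul]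
        · intro x x' hx
          have hxx : ∀ a ∈ S b, x a = x' a := fun a ha => hx a (by simp [ha])
          have hprod : ∀ t, ∏ a ∈ S b, W (x a) t = ∏ a ∈ S b, W (x' a) t := fun t =>
            Finset.prod_congr rfl fun a ha => by rw [hxx a ha]
          simp only [d, hprod]
      refine (expect_mono hstep).trans ?_
      rw [Finset.expect_comm]
      refine Finset.expect_le Finset.univ_nonempty fun x _ => ?_
      rw [← Finset.expect_div]
      exact div_self_le_one _
  -- Here `z` is chosen so that `q * z` is `w * ∏ d` wherever `lam y ≠ 0`, and `w ≤ 1`.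
  obtain ⟨hT, hlog⟩ := expect_mul_log_le
    (z := fun i => p * lam i.1 ^ A₀.card / lam i.1 * ∏ b, d b i.2)
    (C := 𝔼 x : A → X, ∏ b, d b x) hq hq1
    (fun i hi => mul_pos (div_pos (mul_pos hp (pow_pos (hlp i hi) _)) (hlp i hi))
      (Finset.prod_pos fun b _ => hdp b i hi)) (by
      rw [← expect_expect (fun y x => lam y / p * (w y x / lam y ^ A₀.card) *
        (p * lam y ^ A₀.card / lam y * ∏ b, d b x))]
      refine Finset.expect_le Finset.univ_nonempty fun y _ => expect_mono fun x => ?_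
      have hD : 0 ≤ ∏ b, d b x := Finset.prod_nonneg fun b _ => hd b x
      rcases eq_or_ne (lam y) 0 with h | h
      · simpa [h] using hD
      · have e : lam y / p * (w y x / lam y ^ A₀.card) *
            (p * lam y ^ A₀.card / lam y * ∏ b, d b x) = w y x * ∏ b, d b x := by
          have := hp.ne'
          field_simp
        rw [e]
        exact mul_le_of_le_one_left hD (hw1 y x))
  have e : ∀ i, q i * Real.log (p * lam i.1 ^ A₀.card / lam i.1 * ∏ b, d b i.2) =
      q i * Real.log p + q i * Real.log (lam i.1) * ((A₀.card : ℝ) - 1)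
        + ∑ b, q i * Real.log (d b i.2) := by
    intro i
    rcases (hq i).eq_or_lt with h | h
    · simp [← h]
    · have hl := hlp i h
      rw [Real.log_mul (by positivity) (Finset.prod_pos fun b _ => hdp b i h).ne',
        Real.log_div (by positivity) hl.ne', Real.log_mul hp.ne' (by positivity), Real.log_pow,
        Real.log_prod fun b _ => (hdp b i h).ne', ← Finset.mul_sum]
      ring
  simp_rw [e] at hlog
  rw [Finset.expect_add_distrib, Finset.expect_add_distrib, hqc, ← Finset.expect_mul, ← hℓ,
    Finset.expect_sum_comm] at hlog
  have hsum := Finset.sum_le_sum fun b (_ : b ∈ Finset.univ) => hb b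
  rw [← Finset.sum_mul] at hsum
  have hk : (1 : ℝ) ≤ A₀.card := by exact_mod_cast hA.card_pos
  rw [← Real.log_le_log_iff (pow_pos hp _) hT, Real.log_pow]
  push_cast
  -- The total is `log p + (|A₀| - 1) ℓ + ∑ |S b| log p`; `A₀` is nonempty, so `ℓ` may be replaced
  -- by `log p`.
  nlinarith [mul_le_mul_of_nonneg_right hℓp (sub_nonneg.2 hk)]

/-- The Sidorenko exponent of a bipartite graph is at most twice the number of its edges. -/
theorem pow_expect_le_expect_bipartite [DecidableEq B] (W : X → Y → ℝ) (h0 : ∀ x y, 0 ≤ W x y)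
    (h1 : ∀ x y, W x y ≤ 1) (E : Finset (A × B)) :
    (𝔼 x, 𝔼 y, W x y) ^ (2 * E.card) ≤
      𝔼 x : A → X, 𝔼 y : B → Y, ∏ e ∈ E, W (x e.1) (y e.2) := by
  rcases E.eq_empty_or_nonempty with rfl | hE
  · simp
  have hp0 : 0 ≤ 𝔼 x, 𝔼 y, W x y := expect_nonneg' fun x => expect_nonneg' fun y => h0 x y
  rcases hp0.eq_or_lt with hp | hp
  · rw [← hp, zero_pow (by have := hE.card_pos; omega)]
    exact expect_nonneg' fun x => expect_nonneg' fun y => Finset.prod_nonneg fun _ _ => h0 _ _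
  have hple : 𝔼 x, 𝔼 y, W x y ≤ 1 := Finset.expect_le Finset.univ_nonempty fun x _ =>
    Finset.expect_le Finset.univ_nonempty fun y _ => h1 x y
  let S : B → Finset A := fun b => {a | (a, b) ∈ E}
  have hprod : ∀ (x : A → X) (y : B → Y), ∏ e ∈ E, W (x e.1) (y e.2) =
      ∏ b, ∏ a ∈ S b, W (x a) (y b) := by
    intro x y
    exact Finset.prod_finset_product_right E Finset.univ S (by simp [S])
  have hcard : ∑ b, (S b).card = E.card := by
    have := Finset.sum_finset_product_right E Finset.univ S (by simp [S]) (f := fun _ => 1)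
    simpa using this.symm
  simp_rw [hprod]
  have hexp : ∀ x : A → X, 𝔼 y : B → Y, ∏ b, ∏ a ∈ S b, W (x a) (y b) =
      ∏ b, 𝔼 y, ∏ a ∈ S b, W (x a) y := fun x =>
    expect_prod_apply fun b t => ∏ a ∈ S b, W (x a) t
  simp_rw [hexp]
  rw [Finset.expect_comm] at hp hple ⊢
  refine le_trans ?_ (pow_expect_le_expect_prod_neighbors W h0 h1 (E.image Prod.fst)
    (hE.image _) S (fun b a ha => Finset.mem_image.2 ⟨(a, b), by simpa [S] using ha, rfl⟩) hp)
  rw [hcard]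
  -- The factor 2: `A₀` consists of the left ends of `E`, so `|A₀| ≤ |E|`.
  refine pow_le_pow_of_le_one hp.le hple ?_
  have := Finset.card_image_le (s := E) (f := Prod.fst)
  omega

end Bipartite

/-! ### From bipartite graphs to `r`-graphs -/

section Density

open scoped Classical in
/-- The indicator function of the `r`-tuples of vertices that span an edge. -/
noncomputable def edgeIndicator {r : ℕ} {W : Type*} (H : RGraph r W) (w : Fin r → W) : ℝ :=
  if Finset.univ.image w ∈ H.edges then 1 else 0

theorem edgeIndicator_nonneg {r : ℕ} {W : Type*} (H : RGraph r W) (w : Fin r → W) :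
    0 ≤ H.edgeIndicator w := by
  unfold edgeIndicator; split_ifs <;> simp

theorem edgeIndicator_le_one {r : ℕ} {W : Type*} (H : RGraph r W) (w : Fin r → W) :
    H.edgeIndicator w ≤ 1 := by
  unfold edgeIndicator; split_ifs <;> simp

open scoped Classical in
theorem homDensity_eq_expect {r : ℕ} {V W : Type*} [Fintype V] [Fintype W] (F : RGraph r V)
    (H : RGraph r W) : F.homDensity H = 𝔼 φ : V → W, if F.IsHom H φ then (1 : ℝ) else 0 := by
  rw [homDensity, homCount, Nat.card_eq_fintype_card, Fintype.card_subtype,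
    Fintype.expect_eq_sum_div_card, Finset.sum_boole, Fintype.card_fun, Nat.cast_pow]

theorem homDensity_complete {r : ℕ} {W : Type*} [Fintype W] (H : RGraph r W) :
    (complete r (Fin r)).homDensity H = 𝔼 w, H.edgeIndicator w := by
  classical
  rw [homDensity_eq_expect]
  refine Finset.expect_congr (by ext; simp) fun w _ => ?_
  have huniv : (complete r (Fin r)).edges = {Finset.univ} := by
    have := Finset.powersetCard_self (Finset.univ : Finset (Fin r))
    rwa [Finset.card_univ, Fintype.card_fin] at this
  have : (complete r (Fin r)).IsHom H w ↔ Finset.univ.image w ∈ H.edges := by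
    unfold IsHom
    simp only [huniv, Finset.mem_singleton, forall_eq]
    constructor
    · rintro ⟨f, hf, h⟩
      rwa [show Finset.univ.image w = f from Finset.coe_injective (by simpa using h)]
    · intro h
      exact ⟨_, h, by simp⟩
  simp only [edgeIndicator, this]

/-- Constant tuples never span an edge. -/
theorem homDensity_complete_lt_one {r : ℕ} (hr : 2 ≤ r) {W : Type*} [Fintype W] [Nonempty W]
    (H : RGraph r W) : (complete r (Fin r)).homDensity H < 1 := by
  classical
  rw [homDensity_complete]
  obtain ⟨w⟩ := ‹Nonempty W›
  refine Finset.expect_lt (fun _ _ => edgeIndicator_le_one _ _) ⟨fun _ => w, Finset.mem_univ _, ?_⟩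
  rw [edgeIndicator, if_neg]
  · exact one_pos
  · intro h
    have h1 := H.card_of_mem _ h
    have h2 := Finset.card_le_card
      (Finset.image_subset_iff.2 fun (_ : Fin r) _ => Finset.mem_singleton_self w :
        Finset.univ.image (fun _ : Fin r => w) ⊆ {w})
    rw [Finset.card_singleton] at h2
    omega

/-- The edges of an `r`-partite `r`-graph, listed in the order of the parts. -/
theorem exists_edge_enumeration {r : ℕ} {V : Type*} {F : RGraph r V} {χ : V → Fin r}
    (hχ : ∀ e ∈ F.edges, ∀ i : Fin r, ∃! v, v ∈ e ∧ χ v = i) :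
    ∃ t : F.edges → Fin r → V, ∀ e, (∀ i, χ (t e i) = i) ∧ Set.range (t e) = (e.1 : Set V) := by
  choose t ht htu using fun e : F.edges => hχ e e.2
  refine ⟨t, fun e => ⟨fun i => (ht e i).2, Set.Subset.antisymm ?_ ?_⟩⟩
  · rintro _ ⟨i, rfl⟩
    exact (ht e i).1
  · intro v hv
    exact ⟨χ v, (htu e (χ v) v ⟨hv, rfl⟩).symm⟩

/-- The homomorphism density of an `r`-partite `r`-graph with `r = k + 2` is at least
`p ^ (2 e(F) v(F) ^ k)`, where `p` is the edge density of the target. -/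
theorem pow_le_homDensity {k : ℕ} {V W : Type*} [Fintype V] [Fintype W] [Nonempty W]
    (F : RGraph (k + 2) V) (hF : F.IsRPartite) (H : RGraph (k + 2) W) :
    (complete (k + 2) (Fin (k + 2))).homDensity H ^ (2 * F.edges.card * Fintype.card V ^ k) ≤
      F.homDensity H := by
  classical
  obtain ⟨χ, hχ⟩ := hF
  obtain ⟨t, ht⟩ := exists_edge_enumeration hχ
  let h : W → W → (Fin k → W) → ℝ := fun x y w => H.edgeIndicator (Fin.cons x (Fin.cons y w))
  have hh0 : ∀ x y w, 0 ≤ h x y w := fun _ _ _ => edgeIndicator_nonneg _ _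
  have hh1 : ∀ x y w, h x y w ≤ 1 := fun _ _ _ => edgeIndicator_le_one _ _
  let L : (Fin k → V → W) → W → W → ℝ := fun ψ x y => ∏ z : Fin k → V, h x y fun i => ψ i (z i)
  have hL0 : ∀ ψ x y, 0 ≤ L ψ x y := fun _ _ _ => Finset.prod_nonneg fun _ _ => hh0 _ _ _
  have hL1 : ∀ ψ x y, L ψ x y ≤ 1 := fun _ _ _ =>
    Finset.prod_le_one (fun _ _ => hh0 _ _ _) fun _ _ => hh1 _ _ _
  let E : Finset (V × V) := F.edges.attach.image fun e => (t e 0, t e 1)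
  have hE : E.card ≤ F.edges.card := Finset.card_image_le.trans_eq (Finset.card_attach)
  let Q : (Fin (k + 2) → V → W) → ℝ := fun ψ =>
    if F.IsHom H (fun v => ψ (χ v) v) then 1 else 0
  have hhom : ∀ (x y : V → W) (ψ : Fin k → V → W), ∏ e ∈ E, L ψ (x e.1) (y e.2) ≤
      Q (Fin.cons x (Fin.cons y ψ)) := by
    intro x y ψ
    simp only [Q]
    split_ifs with hφ
    · exact Finset.prod_le_one (fun _ _ => hL0 _ _ _) fun _ _ => hL1 _ _ _
    · refine le_of_eq ?_
      by_contra hne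
      refine hφ fun e he => ?_
      have h1 := Finset.prod_ne_zero_iff.1 hne (t ⟨e, he⟩ 0, t ⟨e, he⟩ 1)
        (Finset.mem_image_of_mem _ (Finset.mem_attach _ ⟨e, he⟩))
      -- Among all factors of `L ψ`, take the one indexed by the remaining vertices of `e`.
      have h2 := Finset.prod_ne_zero_iff.1 h1 (fun i => t ⟨e, he⟩ i.succ.succ) (Finset.mem_univ _)
      simp only [h, edgeIndicator, ne_eq, ite_eq_right_iff, one_ne_zero, imp_false, not_not] at h2
      refine ⟨_, h2, ?_⟩
      obtain ⟨hχt, hrange⟩ := ht ⟨e, he⟩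
      rw [← hrange, ← Set.range_comp, Finset.coe_image, Finset.coe_univ, Set.image_univ]
      congr 1
      funext i
      simp only [Function.comp, hχt]
      refine Fin.cases rfl (fun i => Fin.cases rfl (fun i => rfl) i) i
  have hp0 : 0 ≤ 𝔼 x, 𝔼 y, 𝔼 w, h x y w :=
    expect_nonneg' fun _ => expect_nonneg' fun _ => expect_nonneg' fun _ => hh0 _ _ _
  have hp1 : 𝔼 x, 𝔼 y, 𝔼 w, h x y w ≤ 1 :=
    Finset.expect_le Finset.univ_nonempty fun _ _ => Finset.expect_le Finset.univ_nonempty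
      fun _ _ => Finset.expect_le Finset.univ_nonempty fun _ _ => hh1 _ _ _
  have hblow : (𝔼 x, 𝔼 y, 𝔼 w, h x y w) ^ Fintype.card V ^ k ≤ 𝔼 ψ, 𝔼 x, 𝔼 y, L ψ x y := by
    have hb := pow_expect_le_expect_prod (V := V) k
      (fun (ζ : ULift (W × W)) w => h ζ.down.1 ζ.down.2 w) fun _ _ => hh0 _ _ _
    have hlift : ∀ f : W × W → ℝ, 𝔼 ζ : ULift (W × W), f ζ.down = 𝔼 ζ, f ζ := fun f =>
      Fintype.expect_equiv Equiv.ulift _ _ fun _ => rfl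
    rw [hlift (fun ζ => 𝔼 w, h ζ.1 ζ.2 w),
      hlift (fun ζ => 𝔼 ψ : Fin k → V → W, ∏ z : Fin k → V, h ζ.1 ζ.2 fun i => ψ i (z i)),
      ← expect_expect (fun x y => 𝔼 w, h x y w), Finset.expect_comm (s := Finset.univ (α := W × W))]
      at hb
    refine hb.trans_eq (Finset.expect_congr rfl fun ψ _ => ?_)
    exact (expect_expect (fun x y => L ψ x y)).symm
  have hdens : (complete (k + 2) (Fin (k + 2))).homDensity H = 𝔼 x, 𝔼 y, 𝔼 w, h x y w := by
    rw [homDensity_complete, expect_fin_succ]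
    exact Finset.expect_congr rfl fun x _ => expect_fin_succ _
  have hgraph : 𝔼 ψ, (𝔼 x, 𝔼 y, L ψ x y) ^ (2 * E.card) ≤
      𝔼 x : V → W, 𝔼 y : V → W, 𝔼 ψ, ∏ e ∈ E, L ψ (x e.1) (y e.2) := by
    have hcomm : 𝔼 x : V → W, 𝔼 y : V → W, 𝔼 ψ, ∏ e ∈ E, L ψ (x e.1) (y e.2) =
        𝔼 ψ, 𝔼 x : V → W, 𝔼 y : V → W, ∏ e ∈ E, L ψ (x e.1) (y e.2) := by
      rw [Finset.expect_comm (s := Finset.univ (α := Fin k → V → W))]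
      exact Finset.expect_congr rfl fun x _ => Finset.expect_comm _ _ _
    rw [hcomm]
    exact expect_mono fun ψ => pow_expect_le_expect_bipartite (L ψ) (hL0 ψ) (hL1 ψ) E
  rw [hdens]
  calc (𝔼 x, 𝔼 y, 𝔼 w, h x y w) ^ (2 * F.edges.card * Fintype.card V ^ k)
      ≤ (𝔼 x, 𝔼 y, 𝔼 w, h x y w) ^ (Fintype.card V ^ k * (2 * E.card)) := by
        refine pow_le_pow_of_le_one hp0 hp1 ?_
        rw [mul_comm]
        exact Nat.mul_le_mul_right _ (Nat.mul_le_mul_left _ hE)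
    _ ≤ (𝔼 ψ, 𝔼 x, 𝔼 y, L ψ x y) ^ (2 * E.card) := by
        rw [pow_mul]
        exact pow_le_pow_left₀ (pow_nonneg hp0 _) hblow _
    _ ≤ 𝔼 ψ, (𝔼 x, 𝔼 y, L ψ x y) ^ (2 * E.card) :=
        pow_expect_le (fun ψ => expect_nonneg' fun _ => expect_nonneg' fun _ => hL0 _ _ _) _
    _ ≤ 𝔼 x : V → W, 𝔼 y : V → W, 𝔼 ψ, ∏ e ∈ E, L ψ (x e.1) (y e.2) := hgraph
    _ ≤ 𝔼 x : V → W, 𝔼 y : V → W, 𝔼 ψ : Fin k → V → W,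
          Q (Fin.cons x (Fin.cons y ψ)) :=
        expect_mono fun x => expect_mono fun y => expect_mono fun ψ => hhom x y ψ
    _ = F.homDensity H := by
        rw [homDensity_eq_expect,
          expect_diagonal χ (fun φ : V → W => if F.IsHom H φ then (1 : ℝ) else 0)]
        refine Eq.trans ?_ (expect_fin_succ Q).symm
        exact Finset.expect_congr rfl fun x _ =>
          (expect_fin_succ fun ψ : Fin (k + 1) → V → W => Q (Fin.cons x ψ)).symm

end Density

end RGraph

/-! ### Comparison of exponents -/

theorem theorem2p3 {r : ℕ} (hr : 2 ≤ r) {V : Type*} [Fintype V] (F : RGraph r V)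
    (hF : F.IsRPartite) (c : ℝ) (hc : 0 < c)
    (hcard : (F.edges.card : ℝ) = c * (Fintype.card V : ℝ)) :
    F.sidorenkoExponent ≤ ENNReal.ofReal (2 * c * (Fintype.card V : ℝ) ^ (r - 1)) := by
  refine iSup₂_le fun s hs => ENNReal.ofReal_le_ofReal ?_
  obtain ⟨-, W, _, _, H, hst, hpos⟩ := hs
  have hlt := RGraph.homDensity_complete_lt_one hr H
  obtain ⟨k, rfl⟩ := Nat.exists_eq_add_of_le' hr
  have hle := RGraph.pow_le_homDensity F hF H
  have hp0 : 0 ≤ (RGraph.complete (k + 2) (Fin (k + 2))).homDensity H := by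
    rw [RGraph.homDensity_complete]
    exact RGraph.expect_nonneg' fun _ => RGraph.edgeIndicator_nonneg _ _
  have hM : 2 * c * (Fintype.card V : ℝ) ^ (k + 2 - 1) =
      ((2 * F.edges.card * Fintype.card V ^ k : ℕ) : ℝ) := by
    rw [show k + 2 - 1 = k + 1 from rfl, pow_succ]
    push_cast
    rw [hcard]
    ring
  rw [hM]
  rcases hp0.eq_or_lt with hp | hp
  · have hs0 : s = 0 := by
      by_contra hs0
      rw [hst, ← hp, Real.zero_rpow hs0] at hpos
      exact hpos.false
    rw [hs0]
    exact Nat.cast_nonneg _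
  · rw [hst, ← Real.rpow_natCast] at hle
    exact (Real.rpow_le_rpow_left_iff_of_base_lt_one hp hlt).1 hle
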